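/- Fix a finite alphabet $A$. A class $\mathcal{C}$ of languages over $A$ (a set of subsets of $A^*$) is a quotienting lattice of regular languages if all its members are regular, $\emptyset, A^* \in \mathcal{C}$, and $\mathcal{C}$ is closed under union, intersection, and the left and right quotients $u^{-1}L = \{w \in A^* \mid uw \in L\}$ and $Lu^{-1} = \{w \in A^* \mid wu \in L\}$ for all $u \in A^*$. The polynomial closure $\mathrm{Pol}(\mathcal{C})$ is the smallest class of languages over $A$ that contains $\mathcal{C}$ and is closed under union and under marked concatenation: $H \cup L$ and $HaL = \{uav \mid u \in H,\ v \in L\}$ belong to $\mathrm{Pol}(\mathcal{C})$ for all $H, L \in \mathrm{Pol}(\mathcal{C})$ and $a \in A$. For a class $\mathcal{D}$, the $\mathcal{D}$-membership problem takes as input a regular language $L \subseteq A^*$ and asks whether $L \in \mathcal{D}$. The $\mathcal{D}$-separation problem takes as input two regular languages $L_1, L_2 \subseteq A^*$ and asks whether there is $K \in \mathcal{D}$ with $L_1 \subseteq K$ and $L_2 \cap K = \emptyset$. In both problems, regular languages are given by nondeterministic finite automata. **Theorem.** Let $\mathcal{C}$ be a quotienting lattice of regular languages over $A$. If $\mathcal{C}$-separation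 is decidable, then $\mathrm{Pol}(\mathcal{C})$-membership is decidable. -/

import Mathlib

namespace PolClosure

variable {A : Type*}

/-- The right quotient `L u⁻¹ = {w | w u ∈ L}`
(the left quotient `u⁻¹ L` is `Language.leftQuotient`). -/
def rightQuotient (L : Language A) (u : List A) : Language A := {w | w ++ u ∈ L}

/-- A quotienting lattice of regular languages over `A`. -/
structure IsQuotientingLattice (C : Set (Language A)) : Prop where
  regular : ∀ L ∈ C, L.IsRegular
  empty_mem : (⊥ : Language A) ∈ C
  univ_mem : (⊤ : Language A) ∈ C
  union_mem : ∀ K ∈ C, ∀ L ∈ C, K ⊔ L ∈ C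
  inter_mem : ∀ K ∈ C, ∀ L ∈ C, K ⊓ L ∈ C
  leftQuotient_mem : ∀ L ∈ C, ∀ u : List A, L.leftQuotient u ∈ C
  rightQuotient_mem : ∀ L ∈ C, ∀ u : List A, rightQuotient L u ∈ C

/-- Membership in the polynomial closure of `C`, generated from `C` by union and by marked
concatenation `H, L ↦ H a L`, for every letter `a`. -/
inductive InPol (C : Set (Language A)) : Language A → Prop
  | basic {L : Language A} (hL : L ∈ C) : InPol C L
  | union {H L : Language A} (hH : InPol C H) (hL : InPol C L) : InPol C (H ⊔ L)
  | marked {H L : Language A} (a : A) (hH : InPol C H) (hL : InPol C L) :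
      InPol C (H * {[a]} * L)

/-- The polynomial closure of `C`: the smallest class of languages containing `C` and closed under
union and under marked concatenation. -/
def Pol (C : Set (Language A)) : Set (Language A) := {L | InPol C L}

/-- `K` separates `L₁` from `L₂`. -/
def Separates (K L₁ L₂ : Language A) : Prop := L₁ ≤ K ∧ L₂ ⊓ K = ⊥

/-- `L₁` is `C`-separable from `L₂`. -/
def Separable (C : Set (Language A)) (L₁ L₂ : Language A) : Prop :=
  ∃ K ∈ C, Separates K L₁ L₂

/-- A nondeterministic finite automaton over `A`, as a finite object that an algorithm can take as
input: the list of initial states, the list of transitions `(p, a, q)` and the list of final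
states. States are named by natural numbers. -/
abbrev Automaton (A : Type*) : Type _ := List ℕ × List (ℕ × A × ℕ) × List ℕ

namespace Automaton

/-- The automaton written down by `M`. -/
def toNFA (M : Automaton A) : NFA A ℕ where
  step p a := {q | (p, a, q) ∈ M.2.1}
  start := {q | q ∈ M.1}
  accept := {q | q ∈ M.2.2}

/-- The language accepted by `M`. -/
def language (M : Automaton A) : Language A := M.toNFA.accepts

end Automaton

/-- `C`-membership is decidable: some algorithm takes (an automaton for) a regular language `L` and
decides whether `L ∈ C`. -/
def MembershipDecidable [Primcodable A] (C : Set (Language A)) : Prop :=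
  ComputablePred fun M : Automaton A => M.language ∈ C

/-- `C`-separation is decidable: some algorithm takes (automata for) regular languages `L₁`, `L₂`
and decides whether `L₁` is `C`-separable from `L₂`. -/
def SeparationDecidable [Primcodable A] (C : Set (Language A)) : Prop :=
  ComputablePred fun M : Automaton A × Automaton A => Separable C M.1.language M.2.language

/-- Over a finite alphabet, the languages accepted by the automata above are exactly the regular
languages. -/
theorem isRegular_iff_exists_automaton [Finite A] (L : Language A) :
    L.IsRegular ↔ ∃ M : Automaton A, M.language = L := by
  constructor
  · rintro ⟨σ, _, D, rfl⟩
    have := Fintype.ofFinite A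
    classical
    let e : σ ≃ Fin (Fintype.card σ) := Fintype.equivFin σ
    have hinj : ∀ s t : σ, (e s : ℕ) = e t ↔ s = t := fun s t => by
      rw [← Fin.ext_iff, e.apply_eq_iff_eq]
    let M : Automaton A := ([(e D.start : ℕ)],
      (Finset.univ : Finset (σ × A)).toList.map
        (fun x => ((e x.1 : ℕ), x.2, (e (D.step x.1 x.2) : ℕ))),
      ((Finset.univ : Finset σ).toList.filter (· ∈ D.accept)).map (fun s => (e s : ℕ)))
    refine ⟨M, ?_⟩
    have hstep : ∀ s a, M.toNFA.stepSet {(e s : ℕ)} a = {(e (D.step s a) : ℕ)} := by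
      intro s a
      ext q
      simp only [NFA.stepSet_singleton, Set.mem_singleton_iff]
      simp only [Automaton.toNFA, M, Set.mem_ofPred_eq, List.mem_map, Finset.mem_toList,
        Finset.mem_univ, true_and, Prod.mk.injEq, Prod.exists, hinj]
      constructor
      · rintro ⟨s', a', rfl, rfl, h⟩
        exact h.symm
      · rintro rfl
        exact ⟨s, a, rfl, rfl, rfl⟩
    have heval : ∀ (w : List A) (s : σ),
        M.toNFA.evalFrom {(e s : ℕ)} w = {(e (D.evalFrom s w) : ℕ)} := by
      intro w
      induction w with
      | nil => intro s; rfl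
      | cons a w ih => intro s; rw [NFA.evalFrom_cons, hstep, ih, DFA.evalFrom_cons]
    have hstart : M.toNFA.start = {(e D.start : ℕ)} := by
      ext q; simp [Automaton.toNFA, M]
    ext w
    change (∃ s ∈ M.toNFA.accept, s ∈ M.toNFA.evalFrom M.toNFA.start w) ↔
      D.evalFrom D.start w ∈ D.accept
    rw [hstart, heval]
    simp [Automaton.toNFA, M, hinj]
  · rintro ⟨M, rfl⟩
    apply Language.IsRegular.of_finite_range_leftQuotient
    let F : Set ℕ := {q | q ∈ M.1} ∪ {q | q ∈ M.2.1.map fun t => t.2.2}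
    have hF : F.Finite := (List.finite_toSet _).union (List.finite_toSet _)
    have hsub : ∀ (w : List A) (S : Set ℕ), S ⊆ F → M.toNFA.evalFrom S w ⊆ F := by
      intro w
      induction w with
      | nil => intro S hS; exact hS
      | cons a w ih =>
        intro S _
        refine ih _ fun q hq => ?_
        obtain ⟨p, _, hp⟩ := NFA.mem_stepSet.1 hq
        exact Or.inr (List.mem_map.2 ⟨(p, a, q), hp, rfl⟩)
    refine (hF.finite_subsets.image M.toNFA.acceptsFrom).subset ?_
    rintro _ ⟨w, rfl⟩
    refine ⟨M.toNFA.evalFrom M.toNFA.start w, hsub w _ fun q hq => Or.inl hq, ?_⟩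
    ext v
    exact (NFA.append_mem_acceptsFrom M.toNFA).symm

end PolClosure

/-! Membership in `Pol C` is characterised by finitely many separation questions. Let `α` be a
morphism onto a finite monoid that recognizes `L`. Then `L ∈ Pol C` iff `e ≤ e t e` in the syntactic
preorder whenever `e` is idempotent and the fiber of `e` is not `C`-separable from the fiber of `t`
(`PolCriterion`, `mem_pol_iff_polCriterion`).

Necessity (`polCriterion_of_inPol`): a language of `Pol C` is built from finitely many languages of
`C` and finitely many marked letters. In a long power of `u` the marked letters leave a long block
intact, where a copy of `u` may be replaced by any `v` that the relevant languages of `C` do not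
distinguish from `u` (`InPol.exists_finite_insert`). Inseparability supplies such `u` and `v` in the
two fibers.

Sufficiency (`inPol_of_polCriterion`): each fiber is covered by a language of `Pol C` lying above it
in the syntactic preorder, so `L` is the union of the covers of its fibers. Covers are built from
letters by unions and products; iteration is needed only for sets with a single idempotent image
(`IsIterationIdeal.closure_mem`, a form of the factorization forest theorem). There the criterion
applies: in a long product the two outer factors are kept and the middle is covered by a single
language of `C`.

Decidability: for the transition monoid of an automaton, short words represent all elements and each
fiber has a computable automaton. The criterion thus becomes a bounded quantification over decidable
conditions and calls to `C`-separation. -/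

namespace PolClosure

open scoped Pointwise

/-! ### Factorization forests: reducing iteration to iteration over one idempotent. -/

/-- A family of subsets of a monoid that is closed under subsets, finite unions, products, and
generated submonoids of those members that `α` maps to a single idempotent. -/
structure IsIterationIdeal {W M : Type*} [Monoid W] [Monoid M] (α : W →* M)
    (G : Set (Set W)) : Prop where
  mono : ∀ {X Y : Set W}, X ∈ G → Y ⊆ X → Y ∈ G
  singleton_one_mem : {1} ∈ G
  union : ∀ {X Y : Set W}, X ∈ G → Y ∈ G → X ∪ Y ∈ G
  mul : ∀ {X Y : Set W}, X ∈ G → Y ∈ G → X * Y ∈ G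
  iterate : ∀ {X : Set W} {e : M}, X ∈ G → e * e = e → (∀ x ∈ X, α x = e) →
    (Submonoid.closure X : Set W) ∈ G

/-- Nonempty products of elements of `X` such that, reading the product from the state `g`, every
proper nonempty prefix leads to a state in `T`. -/
inductive PathVia {W M : Type*} [Monoid W] [Monoid M] (α : W →* M) (X : Set W) (T : Set M)
    (g : M) : W → Prop
  | single {x : W} (hx : x ∈ X) : PathVia α X T g x
  | snoc {w x : W} (hw : PathVia α X T g w) (hT : g * α w ∈ T) (hx : x ∈ X) :
      PathVia α X T g (w * x)

namespace IsIterationIdeal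

variable {W M : Type*} [Monoid W] [Monoid M] {α : W →* M} {G : Set (Set W)}

/-- Splitting a product at the factors that belong to `C`. -/
theorem closure_union_subset (B C : Set W) :
    (Submonoid.closure (B ∪ C) : Set W) ⊆
      (Submonoid.closure B : Set W) *
        (Submonoid.closure (C * (Submonoid.closure B : Set W)) : Set W) := by
  intro w hw
  induction hw using Submonoid.closure_induction_left with
  | one => exact ⟨1, one_mem _, 1, one_mem _, by simp⟩
  | mul_left x hx y _ ih =>
    obtain ⟨b, hb, z, hz, rfl⟩ := ih
    rcases hx with hx | hx
    · exact ⟨x * b, mul_mem (Submonoid.subset_closure hx) hb, z, hz, mul_assoc _ _ _⟩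
    · refine ⟨1, one_mem _, x * b * z, mul_mem (Submonoid.subset_closure ⟨x, hx, b, hb, rfl⟩) hz,
        ?_⟩
      simp [mul_assoc]

/-- Factors are grouped in pairs, with at most one left over. Pairing matters in `closure_mem`: a
single factor may have image `c`, while the image of a pair lies in `c S`. -/
theorem closure_subset_closure_mul_self (Y : Set W) :
    (Submonoid.closure Y : Set W) ⊆ (Submonoid.closure (Y * Y) : Set W) * ({1} ∪ Y) := by
  intro w hw
  induction hw using Submonoid.closure_induction_right with
  | one => exact ⟨1, one_mem _, 1, Or.inl rfl, by simp⟩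
  | mul_right x _ y hy ih =>
    obtain ⟨z, hz, t, rfl | ht, rfl⟩ := ih
    · exact ⟨z, hz, y, Or.inr hy, by simp⟩
    · exact ⟨z * (t * y), mul_mem hz (Submonoid.subset_closure ⟨t, ht, y, hy, rfl⟩), 1,
        Or.inl rfl, by simp [mul_assoc]⟩

/-- Kleene's state elimination: the path is cut at its first and last intermediate visits to `s`,
and what lies between is a product of loops at `s` that do not pass through `s` internally. -/
theorem pathVia_insert {X : Set W} {T : Set M} {s g : M} {w : W}
    (hw : PathVia α X (insert s T) g w) :
    PathVia α X T g w ∨ ∃ a l b, PathVia α X T g a ∧ g * α a = s ∧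
      l ∈ Submonoid.closure {y | PathVia α X T s y ∧ s * α y = s} ∧ s * α l = s ∧
      PathVia α X T s b ∧ w = a * l * b := by
  induction hw with
  | single hx => exact Or.inl (.single hx)
  | @snoc w x hw hT hx ih =>
    rcases ih with h | ⟨a, l, b, ha, has, hl, hls, hb, rfl⟩
    · rcases hT with hT | hT
      · exact Or.inr ⟨w, 1, x, h, hT, one_mem _, by simp, .single hx, by simp⟩
      · exact Or.inl (.snoc h hT hx)
    · have key : g * α (a * l * b) = s * α b := by
        rw [map_mul, map_mul, ← mul_assoc, ← mul_assoc, has, hls]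
      rw [key] at hT
      rcases hT with hT | hT
      · refine Or.inr ⟨a, l * b, x, ha, has, mul_mem hl (Submonoid.subset_closure ⟨hb, hT⟩), ?_,
          .single hx, by simp [mul_assoc]⟩
        rw [map_mul, ← mul_assoc, hls, hT]
      · exact Or.inr ⟨a, l, b * x, ha, has, hl, hls, .snoc hb hT hx, by simp [mul_assoc]⟩

theorem pathVia_image_mem {X : Set W} {T : Set M} {g : M} {w : W} (hw : PathVia α X T g w) :
    α w ∈ Subsemigroup.closure (α '' X) := by
  induction hw with
  | single hx => exact Subsemigroup.subset_closure ⟨_, hx, rfl⟩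
  | snoc _ _ hx ih =>
    rw [map_mul]
    exact mul_mem ih (Subsemigroup.subset_closure ⟨_, hx, rfl⟩)

/-- Kleene's algorithm, adding one intermediate state at a time. The only stars that arise are over
loops at a state `s`, whose images stabilize `s`; `hstab` handles exactly those. -/
theorem pathVia_mem (hG : IsIterationIdeal α G) {X : Set W} (hX : X ∈ G)
    (hstab : ∀ s ∈ Subsemigroup.closure (α '' X), ∀ Y ∈ G,
      (∀ y ∈ Y, α y ∈ Subsemigroup.closure (α '' X) ∧ s * α y = s) →
      (Submonoid.closure Y : Set W) ∈ G)
    {T : Set M} (hfin : T.Finite) (hT : T ⊆ Subsemigroup.closure (α '' X)) :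
    ∀ g, {w | PathVia α X T g w} ∈ G := by
  induction T, hfin using Set.Finite.induction_on with
  | empty =>
    intro g
    refine hG.mono hX fun w hw => ?_
    cases hw with
    | single hx => exact hx
    | snoc _ h _ => exact h.elim
  | @insert s T _ _ ih =>
    have ih := ih ((Set.subset_insert _ _).trans hT)
    intro g
    refine hG.mono (hG.union (ih g) (hG.mul (hG.mul (ih g)
      (hstab s (hT (Set.mem_insert _ _)) {y | PathVia α X T s y ∧ s * α y = s}
        (hG.mono (ih s) fun y hy => hy.1) fun y hy => ⟨pathVia_image_mem hy.1, hy.2⟩))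
      (ih s))) ?_
    intro w hw
    rcases pathVia_insert hw with h | ⟨a, l, b, ha, -, hl, -, hb, rfl⟩
    · exact Or.inl h
    · exact Or.inr ⟨a * l, ⟨a, ha, l, hl, rfl⟩, b, hb, rfl⟩

theorem closure_subset_pathVia (X : Set W) :
    (Submonoid.closure X : Set W) ⊆
      {1} ∪ {w | PathVia α X (Subsemigroup.closure (α '' X)) 1 w} := by
  intro w hw
  induction hw using Submonoid.closure_induction_right with
  | one => exact Or.inl rfl
  | mul_right x _ y hy ih =>
    rcases ih with rfl | h
    · exact Or.inr (by simpa using PathVia.single hy)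
    · exact Or.inr (.snoc h (by simpa using pathVia_image_mem h) hy)

/-- A qualitative form of the factorization forest theorem. -/
theorem closure_mem [Finite M] (hG : IsIterationIdeal α G) {X : Set W} (hX : X ∈ G) :
    (Submonoid.closure X : Set W) ∈ G := by
  -- Lexicographic induction: first on the size of the subsemigroup `S` generated by `α '' X`, then
  -- on the size of `α '' X`.
  generalize hn : (Subsemigroup.closure (α '' X) : Set M).ncard = n
  induction n using Nat.strong_induction_on generalizing X with
  | _ n ihn =>
  generalize hm : (α '' X).ncard = m
  induction m using Nat.strong_induction_on generalizing X with
  | _ m ihm =>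
  set S := Subsemigroup.closure (α '' X) with hS
  have hsmall : ∀ (U : Subsemigroup M), (U : Set M) ⊂ S → ∀ Y ∈ G, (∀ y ∈ Y, α y ∈ U) →
      (Submonoid.closure Y : Set W) ∈ G := by
    intro U hU Y hY hYU
    refine ihn _ ?_ hY rfl
    rw [← hn]
    refine Set.ncard_lt_ncard (lt_of_le_of_lt ?_ hU) (Set.toFinite _)
    exact Subsemigroup.closure_le.2 (by rintro _ ⟨y, hy, rfl⟩; exact hYU y hy)
  -- If some generator has `c S ≠ S`, products are cut at the factors with image `c`, using `(B ∪
  -- C)* ⊆ B* (C B*)*`. Otherwise `S` is right simple and state elimination applies.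
  by_cases hc : ∃ c ∈ α '' X, ∃ t ∈ S, ∀ r ∈ S, c * r ≠ t
  · obtain ⟨c, hcX, t, ht, hct⟩ := hc
    have hcS : c ∈ S := Subsemigroup.subset_closure hcX
    have hBG : {x ∈ X | α x ≠ c} ∈ G := hG.mono hX (Set.sep_subset _ _)
    have hCG : {x ∈ X | α x = c} ∈ G := hG.mono hX (Set.sep_subset _ _)
    have hBsub : α '' {x ∈ X | α x ≠ c} ⊆ α '' X := Set.image_mono (Set.sep_subset _ _)
    have hB : (Submonoid.closure {x ∈ X | α x ≠ c} : Set W) ∈ G := by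
      have hle : Subsemigroup.closure (α '' {x ∈ X | α x ≠ c}) ≤ S :=
        Subsemigroup.closure_mono hBsub
      rcases (Set.ncard_le_ncard (show ((Subsemigroup.closure (α '' {x ∈ X | α x ≠ c}) :
        Set M)) ⊆ S from hle) (Set.toFinite _)).lt_or_eq with h | h
      · exact ihn _ (hn ▸ h) hBG rfl
      · refine ihm _ ?_ hBG (h.trans hn) rfl
        rw [← hm]
        refine Set.ncard_lt_ncard ⟨hBsub, fun h => ?_⟩ (Set.toFinite _)
        obtain ⟨x, hx, hxc⟩ := h hcX
        exact hx.2 hxc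
    set Bs : Set W := (Submonoid.closure {x ∈ X | α x ≠ c} : Set W)
    set Y := {x ∈ X | α x = c} * Bs
    have hY : Y ∈ G := hG.mul hCG hB
    have hBs : ∀ b ∈ Bs, α b = 1 ∨ α b ∈ S := by
      intro b hb
      induction hb using Submonoid.closure_induction_right with
      | one => exact Or.inl (map_one α)
      | mul_right x _ y hy ih =>
        have hyS : α y ∈ S := Subsemigroup.subset_closure ⟨y, hy.1, rfl⟩
        rw [map_mul]
        rcases ih with h | h
        · rw [h, one_mul]; exact Or.inr hyS
        · exact Or.inr (mul_mem h hyS)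
    have hYS : ∀ y ∈ Y, α y ∈ S ∧ ∃ r, (r = 1 ∨ r ∈ S) ∧ α y = c * r := by
      rintro _ ⟨x, hx, b, hb, rfl⟩
      have hb' := hBs b hb
      rw [map_mul, hx.2]
      refine ⟨?_, _, hb', rfl⟩
      rcases hb' with h | h
      · rwa [h, mul_one]
      · exact mul_mem hcS h
    -- The images of `Y * Y` lie in `c S`, a subsemigroup of `S` that misses `t`, so the outer
    -- induction applies.
    have hYY : (Submonoid.closure (Y * Y) : Set W) ∈ G := by
      let U : Subsemigroup M :=
        { carrier := {z | ∃ r ∈ S, c * r = z}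
          mul_mem' := by
            rintro _ _ ⟨r, hr, rfl⟩ ⟨r', hr', rfl⟩
            exact ⟨r * (c * r'), mul_mem hr (mul_mem hcS hr'), by simp [mul_assoc]⟩ }
      refine hsmall U ⟨?_, fun h => ?_⟩ _ (hG.mul hY hY) ?_
      · rintro _ ⟨r, hr, rfl⟩
        exact mul_mem hcS hr
      · obtain ⟨r, hr, h⟩ := h ht
        exact hct r hr h
      · rintro _ ⟨y, hy, y', hy', rfl⟩
        obtain ⟨-, r, hr, hyr⟩ := hYS y hy
        obtain ⟨hy'S, -⟩ := hYS y' hy'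
        refine ⟨r * α y', ?_, by rw [map_mul, hyr, mul_assoc]⟩
        rcases hr with rfl | hr
        · rwa [one_mul]
        · exact mul_mem hr hy'S
    have hYs : (Submonoid.closure Y : Set W) ∈ G :=
      hG.mono (hG.mul hYY (hG.union hG.singleton_one_mem hY)) (closure_subset_closure_mul_self Y)
    refine hG.mono (hG.mul hB hYs) ?_
    refine Set.Subset.trans ?_ (closure_union_subset _ _)
    refine Submonoid.closure_mono fun x hx => ?_
    by_cases h : α x = c
    · exact Or.inr ⟨hx, h⟩
    · exact Or.inl ⟨hx, h⟩
  · push Not at hc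
    have hsimple : ∀ s ∈ S, ∀ t ∈ S, ∃ r ∈ S, s * r = t := by
      intro s hs
      induction hs using Subsemigroup.closure_induction with
      | mem c hcX => exact hc c hcX
      | mul x y _ _ hx hy =>
        intro t ht
        obtain ⟨r, hr, rfl⟩ := hx t ht
        obtain ⟨r', hr', rfl⟩ := hy r hr
        exact ⟨r', hr', mul_assoc _ _ _⟩
    refine hG.mono (hG.union hG.singleton_one_mem (pathVia_mem hG hX ?_ (Set.toFinite _) subset_rfl 1))
      (closure_subset_pathVia X)
    intro s hs Y hY hYs
    -- If all of `S` stabilizes `s`, then `s S = S` forces `S = {s}` with `s` idempotent. Otherwise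
    -- the stabilizer is a proper subsemigroup and the outer induction applies.
    by_cases hst : ∀ r ∈ S, s * r = s
    · have hone : ∀ t ∈ S, t = s := fun t ht => by
        obtain ⟨r, hr, rfl⟩ := hsimple s hs t ht
        exact hst r hr
      exact hG.iterate hY (hst s hs) fun y hy => hone _ (hYs y hy).1
    · push Not at hst
      obtain ⟨r, hr, hsr⟩ := hst
      let U : Subsemigroup M :=
        { carrier := {z | z ∈ S ∧ s * z = s}
          mul_mem' := by
            rintro a b ⟨ha, ha'⟩ ⟨hb, hb'⟩
            exact ⟨mul_mem ha hb, by rw [← mul_assoc, ha', hb']⟩ }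
      exact hsmall U ⟨fun z hz => hz.1, fun h => hsr (h hr).2⟩ Y hY hYs

end IsIterationIdeal

end PolClosure

/-! ### Sufficiency of the criterion. -/

namespace PolClosure

open scoped Pointwise

variable {A : Type*} {C : Set (Language A)}

theorem mem_marked {H L : Language A} {a : A} {w : List A} :
    w ∈ H * {[a]} * L ↔ ∃ h ∈ H, ∃ l ∈ L, w = h ++ a :: l := by
  simp only [Language.mem_mul]
  constructor
  · rintro ⟨_, ⟨h, hh, b, hb, rfl⟩, l, hl, rfl⟩
    obtain rfl : b = [a] := hb
    exact ⟨h, hh, l, hl, by simp⟩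
  · rintro ⟨h, hh, l, hl, rfl⟩
    exact ⟨h ++ [a], ⟨h, hh, [a], rfl, rfl⟩, l, hl, by simp⟩

theorem exists_mem_iff_exists {D : Set (Language A)} (hbot : ⊥ ∈ D)
    (hsup : ∀ K ∈ D, ∀ L ∈ D, K ⊔ L ∈ D) {ι : Type*} [Finite ι] (f : ι → Language A)
    (hf : ∀ i, f i ∈ D) : ∃ K ∈ D, ∀ w, w ∈ K ↔ ∃ i, w ∈ f i := by
  have key : ∀ s : Set ι, s.Finite → ∃ K ∈ D, ∀ w, w ∈ K ↔ ∃ i ∈ s, w ∈ f i := by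
    intro s hs
    induction s, hs using Set.Finite.induction_on with
    | empty => exact ⟨⊥, hbot, fun w => ⟨fun h => h.elim, by simp⟩⟩
    | @insert i s _ _ ih =>
      obtain ⟨K, hK, hKs⟩ := ih
      refine ⟨f i ⊔ K, hsup _ (hf i) _ hK, fun w => ?_⟩
      rw [Set.exists_mem_insert, ← hKs]
      rfl
  simpa using key Set.univ Set.finite_univ

theorem exists_mem_iff_forall {D : Set (Language A)} (htop : ⊤ ∈ D)
    (hinf : ∀ K ∈ D, ∀ L ∈ D, K ⊓ L ∈ D) {ι : Type*} [Finite ι] (f : ι → Language A)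
    (hf : ∀ i, f i ∈ D) : ∃ K ∈ D, ∀ w, w ∈ K ↔ ∀ i, w ∈ f i := by
  have key : ∀ s : Set ι, s.Finite → ∃ K ∈ D, ∀ w, w ∈ K ↔ ∀ i ∈ s, w ∈ f i := by
    intro s hs
    induction s, hs using Set.Finite.induction_on with
    | empty => exact ⟨⊤, htop, fun w => ⟨by simp, fun _ => trivial⟩⟩
    | @insert i s _ _ ih =>
      obtain ⟨K, hK, hKs⟩ := ih
      refine ⟨f i ⊓ K, hinf _ (hf i) _ hK, fun w => ?_⟩
      rw [Set.forall_mem_insert, ← hKs]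
      rfl
  simpa using key Set.univ Set.finite_univ

namespace InPol

theorem bot (hC : IsQuotientingLattice C) : InPol C ⊥ := .basic hC.empty_mem

theorem exists_iUnion (hC : IsQuotientingLattice C) {ι : Type*} [Finite ι] (f : ι → Language A)
    (hf : ∀ i, InPol C (f i)) : ∃ K, InPol C K ∧ ∀ w, w ∈ K ↔ ∃ i, w ∈ f i :=
  exists_mem_iff_exists (D := {K | InPol C K}) (bot hC) (fun _ hK _ hL => .union hK hL) f hf

theorem leftQuotient_singleton (hC : IsQuotientingLattice C) {L : Language A} (hL : InPol C L)
    (b : A) : InPol C (L.leftQuotient [b]) := by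
  induction hL with
  | basic hL => exact .basic (hC.leftQuotient_mem _ hL _)
  | union _ _ ihH ihL => exact .union ihH ihL
  | @marked H L a _ hL ihH _ =>
    have hcases : ∀ w, w ∈ (H * {[a]} * L).leftQuotient [b] ↔
        w ∈ H.leftQuotient [b] * {[a]} * L ∨ ([] ∈ H ∧ a = b) ∧ w ∈ L := by
      intro w
      rw [Language.mem_leftQuotient, mem_marked, mem_marked]
      constructor
      · rintro ⟨h, hh, l, hl, e⟩
        rcases h with _ | ⟨c, h⟩
        · simp only [List.singleton_append, List.nil_append, List.cons.injEq] at e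
          obtain ⟨rfl, rfl⟩ := e
          exact Or.inr ⟨⟨hh, rfl⟩, hl⟩
        · simp only [List.cons_append, List.cons.injEq] at e
          obtain ⟨rfl, rfl⟩ := e
          exact Or.inl ⟨h, hh, l, hl, rfl⟩
      · rintro (⟨h, hh, l, hl, rfl⟩ | ⟨⟨hn, rfl⟩, hw⟩)
        · exact ⟨b :: h, hh, l, hl, rfl⟩
        · exact ⟨[], hn, w, hw, rfl⟩
    by_cases hn : [] ∈ H ∧ a = b
    · have : (H * {[a]} * L).leftQuotient [b] = H.leftQuotient [b] * {[a]} * L ⊔ L :=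
        Language.ext fun w => (hcases w).trans (or_congr_right (and_iff_right hn))
      rw [this]
      exact .union (.marked a ihH hL) hL
    · have : (H * {[a]} * L).leftQuotient [b] = H.leftQuotient [b] * {[a]} * L :=
        Language.ext fun w => (hcases w).trans (or_iff_left fun h => hn h.1)
      rw [this]
      exact .marked a ihH hL

/-- The second factor is split by its first letter: `H L` is the union of the `H a (a⁻¹ L)`,
together with `H` if `L` contains the empty word. -/
theorem mul [Finite A] (hC : IsQuotientingLattice C) {H L : Language A} (hH : InPol C H)
    (hL : InPol C L) : InPol C (H * L) := by
  obtain ⟨K, hK, hKw⟩ := exists_iUnion hC (fun a => H * {[a]} * L.leftQuotient [a])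
    fun a => .marked a hH (leftQuotient_singleton hC hL a)
  have hcases : ∀ w, w ∈ H * L ↔ w ∈ K ∨ [] ∈ L ∧ w ∈ H := by
    intro w
    simp only [hKw, mem_marked, Language.mem_leftQuotient]
    rw [Language.mem_mul]
    constructor
    · rintro ⟨h, hh, l, hl, rfl⟩
      rcases l with _ | ⟨a, l⟩
      · exact Or.inr ⟨hl, by simpa using hh⟩
      · exact Or.inl ⟨a, h, hh, l, hl, rfl⟩
    · rintro (⟨a, h, hh, l, hl, rfl⟩ | ⟨hn, hw⟩)
      · exact ⟨h, hh, a :: l, hl, rfl⟩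
      · exact ⟨w, hw, [], hn, by simp⟩
  by_cases hn : [] ∈ L
  · have : H * L = K ⊔ H :=
      Language.ext fun w => (hcases w).trans (or_congr_right (and_iff_right hn))
    rw [this]
    exact .union hK hH
  · have : H * L = K := Language.ext fun w => (hcases w).trans (or_iff_left fun h => hn h.1)
    rwa [this]

end InPol

/-- The syntactic preorder of `L`. -/
def SyntacticLE (L : Language A) (u v : List A) : Prop :=
  ∀ x y, x ++ u ++ y ∈ L → x ++ v ++ y ∈ L

namespace SyntacticLE

variable {L : Language A} {u v w u' v' : List A}

theorem trans (h : SyntacticLE L u v) (h' : SyntacticLE L v w) : SyntacticLE L u w :=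
  fun x y hu => h' x y (h x y hu)

theorem append (h : SyntacticLE L u u') (h' : SyntacticLE L v v') :
    SyntacticLE L (u ++ v) (u' ++ v') := by
  intro x y hu
  have h₁ : x ++ u' ++ (v ++ y) ∈ L := h x (v ++ y) (by simpa using hu)
  have h₂ : x ++ u' ++ v' ++ y ∈ L := h' (x ++ u') y (by simpa using h₁)
  simpa using h₂

end SyntacticLE

section Morphism

variable {M : Type*} [Monoid M] (α : FreeMonoid A →* M)

theorem map_append (u v : List A) : α (u ++ v : List A) = α u * α v :=
  α.map_mul u v

/-- The language of the words with the same image as `u`. -/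
def fiber (u : List A) : Language A := {w | α w = α u}

/-- The language `L` is a union of fibers of `α`. -/
def Recognizes (L : Language A) : Prop := ∀ u v : List A, α u = α v → u ∈ L → v ∈ L

/-- Inseparable pairs `(e, t)` with `e` idempotent satisfy `e ≤ e t e` in the syntactic preorder. -/
def PolCriterion (C : Set (Language A)) (L : Language A) : Prop :=
  ∀ u v : List A, α (u ++ u : List A) = α u → ¬ Separable C (fiber α u) (fiber α v) →
    SyntacticLE L u (u ++ v ++ u)

variable {α} {L : Language A}

theorem Recognizes.syntacticLE (hL : Recognizes α L) {u v : List A} (h : α u = α v) :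
    SyntacticLE L u v := fun x y =>
  hL _ _ (by rw [map_append, map_append, map_append, map_append, h])

/-- `T` is the intersection of separators of the fiber of `u` from each fiber separable from it,
finitely many in all. A word of `T` therefore lies in an inseparable fiber, where the criterion
applies. -/
theorem exists_mem_fiber_subset [Finite M] (hC : IsQuotientingLattice C)
    (h : PolCriterion α C L) (u : List A)
    (hu : α (u ++ u : List A) = α u) :
    ∃ T ∈ C, fiber α u ≤ T ∧ ∀ v ∈ T, SyntacticLE L u (u ++ v ++ u) := by
  have hsep : ∀ m : {m : M // ∃ v : List A, α v = m ∧ Separable C (fiber α u) (fiber α v)},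
      ∃ K ∈ C, fiber α u ≤ K ∧ ∀ v : List A, α v = m → v ∉ K := by
    rintro ⟨_, v, rfl, K, hK, hle, hdisj⟩
    refine ⟨K, hK, hle, fun v' hv' hv'K => ?_⟩
    have : v' ∈ fiber α v ⊓ K := ⟨hv', hv'K⟩
    rw [hdisj] at this
    exact this
  choose K hK hle hdisj using hsep
  obtain ⟨T, hT, hTw⟩ := exists_mem_iff_forall hC.univ_mem hC.inter_mem K hK
  refine ⟨T, hT, fun w hw => (hTw w).2 fun m => hle m hw, fun v hv => ?_⟩
  refine h u v hu fun hs => ?_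
  exact hdisj ⟨α v, v, rfl, hs⟩ v rfl ((hTw v).1 hv _)

/-- The sets of words whose intersection with each fiber is covered by a language of the polynomial
closure that stays above the fiber. -/
def coverable (α : FreeMonoid A →* M) (C : Set (Language A)) (L : Language A) :
    Set (Set (FreeMonoid A)) :=
  {X | ∀ u : List A, ∃ K, InPol C K ∧ (∀ w ∈ X, α w = α u → w ∈ K) ∧ ∀ w ∈ K, SyntacticLE L u w}

theorem coverable_of_subset_fiber (hC : IsQuotientingLattice C) (hL : Recognizes α L)
    {X : Set (FreeMonoid A)} (e : List A) (hX : ∀ w ∈ X, α w = α e) {K : Language A}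
    (hK : InPol C K) (hXK : ∀ w ∈ X, w ∈ K) (hKe : ∀ w ∈ K, SyntacticLE L e w) :
    X ∈ coverable α C L := by
  intro u
  by_cases h : α u = α e
  · exact ⟨K, hK, fun w hw _ => hXK w hw, fun w hw => (hL.syntacticLE h).trans (hKe w hw)⟩
  · exact ⟨⊥, InPol.bot hC, fun w hw hu => h (hu ▸ hX w hw), fun w hw => hw.elim⟩

/-- Unions and products of covers are covers, since the syntactic preorder is compatible with
concatenation. The criterion enters only through `exists_mem_fiber_subset`, for the empty word and
for iteration. -/
theorem isIterationIdeal_coverable [Finite A] [Finite M] (hC : IsQuotientingLattice C)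
    (hL : Recognizes α L) (h : PolCriterion α C L) :
    IsIterationIdeal α (coverable α C L) := by
  have hmono : ∀ {X Y : Set (FreeMonoid A)}, X ∈ coverable α C L → Y ⊆ X →
      Y ∈ coverable α C L := fun hX hYX u => by
    obtain ⟨K, hK, hXK, hKu⟩ := hX u
    exact ⟨K, hK, fun w hw => hXK w (hYX hw), hKu⟩
  have hone : {1} ∈ coverable α C L := by
    obtain ⟨T, hT, hle, hTw⟩ := exists_mem_fiber_subset hC h [] rfl
    refine coverable_of_subset_fiber hC hL [] ?_ (.basic hT) ?_ ?_
    · rintro w rfl; rfl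
    · rintro w rfl; exact hle rfl
    · intro w hw
      simpa using hTw w hw
  have hunion : ∀ {X Y : Set (FreeMonoid A)}, X ∈ coverable α C L → Y ∈ coverable α C L →
      X ∪ Y ∈ coverable α C L := fun hX hY u => by
    obtain ⟨K, hK, hXK, hKu⟩ := hX u
    obtain ⟨K', hK', hYK', hKu'⟩ := hY u
    exact ⟨K ⊔ K', .union hK hK',
      fun w hw hu => hw.imp (fun hw => hXK w hw hu) fun hw => hYK' w hw hu,
      fun w hw => hw.elim (hKu w) (hKu' w)⟩
  have hmul : ∀ {X Y : Set (FreeMonoid A)}, X ∈ coverable α C L → Y ∈ coverable α C L →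
      X * Y ∈ coverable α C L := fun {X Y} hX hY u => by
    -- One product of covers for each of the finitely many factorizations of `α u` in the image of
    -- `α`.
    have hpair : ∀ p : {p : M × M // ∃ x y : List A, α x = p.1 ∧ α y = p.2 ∧ α u = p.1 * p.2},
        ∃ K, InPol C K ∧
          (∀ x ∈ X, ∀ y ∈ Y, α x = p.1.1 → α y = p.1.2 → x * y ∈ (K : Set (FreeMonoid A))) ∧
          ∀ w ∈ K, SyntacticLE L u w := by
      rintro ⟨⟨p, q⟩, x, y, hx, hy, hu⟩
      obtain rfl : α x = p := hx
      obtain rfl : α y = q := hy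
      obtain ⟨K, hK, hXK, hKu⟩ := hX x
      obtain ⟨K', hK', hYK', hKu'⟩ := hY y
      refine ⟨K * K', .mul hC hK hK',
        fun a ha b hb hax hby => Language.append_mem_mul (hXK a ha hax) (hYK' b hb hby), ?_⟩
      rintro _ ⟨k, hk, k', hk', rfl⟩
      refine (hL.syntacticLE ?_).trans ((hKu k hk).append (hKu' k' hk'))
      rw [map_append]
      exact hu
    choose K hK hXY hKu using hpair
    obtain ⟨K', hK', hKw⟩ := InPol.exists_iUnion hC K hK
    refine ⟨K', hK', ?_, fun w hw => ?_⟩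
    · rintro _ ⟨x, hx, y, hy, rfl⟩ hu
      exact (hKw _).2 ⟨⟨(α x, α y), x, y, rfl, rfl, hu ▸ map_mul α x y⟩,
        hXY _ x hx y hy rfl rfl⟩
    · obtain ⟨p, hp⟩ := (hKw w).1 hw
      exact hKu p w hp
  refine ⟨hmono, hone, hunion, hmul, fun {X e} hX he hXe => ?_⟩
  rcases X.eq_empty_or_nonempty with rfl | ⟨u, hu⟩
  · simpa using hone
  have hue := hXe u hu
  have huu : α (u * u) = α u := by rw [map_mul, hue, he]
  obtain ⟨T, hT, hTle, hTw⟩ := exists_mem_fiber_subset hC h u huu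
  obtain ⟨K, hK, hXK, hKu⟩ := hX u
  have hXu : ∀ x ∈ X, α x = α u := fun x hx => (hXe x hx).trans hue.symm
  -- Every product of at least three factors from `X` has this form, because its middle part still
  -- has image `e`. The cover is `K T K`: for `t ∈ T` and `k, k' ∈ K`, `u ≤ u t u ≤ k t k'`.
  have hmid : {w | ∃ x ∈ X, ∃ t, α t = α u ∧ ∃ y ∈ X, w = x * t * y} ∈ coverable α C L := by
    refine coverable_of_subset_fiber hC hL u ?_ ((hK.mul hC (.basic hT)).mul hC hK) ?_ ?_
    · rintro _ ⟨x, hx, t, ht, y, hy, rfl⟩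
      rw [map_mul, map_mul, ht, hXu x hx, hXu y hy, hue, he, he]
    · rintro _ ⟨x, hx, t, ht, y, hy, rfl⟩
      exact Language.append_mem_mul (Language.append_mem_mul (hXK x hx (hXu x hx)) (hTle ht))
        (hXK y hy (hXu y hy))
    · rintro _ ⟨_, ⟨k, hk, t, ht, rfl⟩, k', hk', rfl⟩
      exact (hTw t ht).trans
        (((hKu k hk).append (hL.syntacticLE rfl)).append (hKu k' hk'))
  refine hmono (hunion (hunion (hunion hone hX) (hmul hX hX)) hmid) ?_
  intro w hw
  induction hw using Submonoid.closure_induction_right with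
  | one => exact Or.inl (Or.inl (Or.inl rfl))
  | mul_right w _ x hx ih =>
    rcases ih with ((rfl | hw) | ⟨y, hy, z, hz, rfl⟩) | ⟨y, hy, t, ht, z, hz, rfl⟩
    · exact Or.inl (Or.inl (Or.inr (by simpa using hx)))
    · exact Or.inl (Or.inr ⟨w, hw, x, hx, rfl⟩)
    · exact Or.inr ⟨y, hy, z, hXu z hz, x, hx, rfl⟩
    · refine Or.inr ⟨y, hy, t * z, ?_, x, hx, by simp [mul_assoc]⟩
      rw [map_mul, ht, hXu z hz, hue, he]

/-- The letters are coverable and generate all words, so `closure_mem` makes the set of all words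
coverable. A cover above a word of `L` stays inside `L`. -/
theorem inPol_of_polCriterion [Finite A] [Finite M] (hC : IsQuotientingLattice C)
    (hL : Recognizes α L) (h : PolCriterion α C L) : InPol C L := by
  have hG := isIterationIdeal_coverable hC hL h
  have hletter : ∀ a : A, {FreeMonoid.of a} ∈ coverable α C L := by
    intro a
    -- For the empty word the criterion says that every word of `T` is above it, so `T a T` is above
    -- `a`.
    obtain ⟨T, hT, hle, hTw⟩ := exists_mem_fiber_subset hC h [] rfl
    have hnil : [] ∈ T := hle rfl
    refine coverable_of_subset_fiber hC hL [a] ?_ (.marked a (.basic hT) (.basic hT)) ?_ ?_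
    · rintro _ rfl; rfl
    · rintro _ rfl
      exact mem_marked.2 ⟨[], hnil, [], hnil, rfl⟩
    · intro w hw
      obtain ⟨t, ht, t', ht', rfl⟩ := mem_marked.1 hw
      have h₁ : SyntacticLE L [] t := by simpa using hTw t ht
      have h₂ : SyntacticLE L [] t' := by simpa using hTw t' ht'
      have h₃ : SyntacticLE L [a] [a] := hL.syntacticLE rfl
      simpa using (h₁.append h₃).append h₂
  have hletters : Set.range (FreeMonoid.of : A → FreeMonoid A) ∈ coverable α C L := by
    have : ∀ s : Set A, s.Finite → FreeMonoid.of '' s ∈ coverable α C L := by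
      intro s hs
      induction s, hs using Set.Finite.induction_on with
      | empty => exact hG.mono hG.singleton_one_mem (by simp)
      | @insert a s _ _ ih =>
        rw [Set.image_insert_eq, Set.insert_eq]
        exact hG.union (hletter a) ih
    simpa using this Set.univ Set.finite_univ
  have hall := hG.closure_mem hletters
  rw [FreeMonoid.closure_range_of] at hall
  have hfib : ∀ m : {m : M // ∃ u ∈ L, α u = m}, ∃ K, InPol C K ∧
      (∀ w : List A, α w = m → w ∈ K) ∧ ∀ w ∈ K, w ∈ L := by
    rintro ⟨_, u, hu, rfl⟩
    obtain ⟨K, hK, hcov, hKu⟩ := hall u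
    refine ⟨K, hK, fun w hw => hcov w trivial hw, fun w hw => ?_⟩
    simpa using hKu w hw [] [] (by simpa using hu)
  choose K hK hcov hKL using hfib
  obtain ⟨K', hK', hKw⟩ := InPol.exists_iUnion hC K hK
  have : L = K' := Language.ext fun w => by
    rw [hKw]
    exact ⟨fun hw => ⟨⟨α w, w, hw, rfl⟩, hcov _ w rfl⟩, fun ⟨m, hm⟩ => hKL m w hm⟩
  rwa [this]

end Morphism

end PolClosure

/-! ### Necessity of the criterion. -/

namespace PolClosure

variable {A : Type*} {C : Set (Language A)}

/-- The word `u` repeated `n` times. -/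
def repeatWord (u : List A) (n : ℕ) : List A := (List.replicate n u).flatten

theorem repeatWord_add (u : List A) (m n : ℕ) :
    repeatWord u (m + n) = repeatWord u m ++ repeatWord u n := by
  rw [repeatWord, List.replicate_add, List.flatten_append]
  rfl

theorem repeatWord_one (u : List A) : repeatWord u 1 = u := by simp [repeatWord]

/-- The two-sided quotients of `L`. -/
def quotients (L : Language A) : Set (Language A) :=
  Set.range fun p : List A × List A => ({w | p.1 ++ w ++ p.2 ∈ L} : Language A)

theorem quotients_finite {L : Language A} (hL : L.IsRegular) : (quotients L).Finite := by
  obtain ⟨σ, _, D, rfl⟩ := hL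
  refine (Set.finite_range fun p : σ × Set σ =>
    ({w | D.evalFrom p.1 w ∈ p.2} : Language A)).subset ?_
  rintro _ ⟨⟨x, y⟩, rfl⟩
  refine ⟨(D.eval x, {q | D.evalFrom q y ∈ D.accept}), ?_⟩
  ext w
  change D.evalFrom (D.evalFrom (D.evalFrom D.start x) w) y ∈ D.accept ↔
    D.evalFrom D.start (x ++ w ++ y) ∈ D.accept
  rw [DFA.evalFrom_of_append, DFA.evalFrom_of_append]

theorem quotients_subset (hC : IsQuotientingLattice C) {L : Language A} (hL : L ∈ C) :
    quotients L ⊆ C := by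
  rintro _ ⟨⟨x, y⟩, rfl⟩
  have : ({w | x ++ w ++ y ∈ L} : Language A) = rightQuotient (L.leftQuotient x) y := by
    ext w
    change x ++ w ++ y ∈ L ↔ x ++ (w ++ y) ∈ L
    rw [List.append_assoc]
  change ({w | x ++ w ++ y ∈ L} : Language A) ∈ C
  rw [this]
  exact hC.rightQuotient_mem _ (hC.leftQuotient_mem _ hL x) y

/-- Replacing one of many consecutive copies of `u` by `v` preserves membership in a language of
the polynomial closure, if `v` belongs to all languages of a suitable finite subset of `C` that
contain `u`. -/
theorem InPol.exists_finite_insert (hC : IsQuotientingLattice C) {L : Language A}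
    (hL : InPol C L) : ∃ D ⊆ C, D.Finite ∧ ∃ N, ∀ u v, (∀ K ∈ D, u ∈ K → v ∈ K) →
      ∀ n ≥ N, ∀ x y, x ++ repeatWord u n ++ y ∈ L →
        ∃ k k', x ++ repeatWord u (k + 1) ++ v ++ repeatWord u (k' + 1) ++ y ∈ L := by
  induction hL with
  | @basic L hL =>
    -- Three copies leave one of `u` on each side of the replaced one; the context of the replaced
    -- copy defines a quotient of `L`.
    refine ⟨quotients L, quotients_subset hC hL, quotients_finite (hC.regular L hL), 3, ?_⟩
    intro u v huv n hn x y h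
    obtain ⟨n, rfl⟩ := Nat.exists_eq_add_of_le hn
    have := huv {w | (x ++ u) ++ w ++ (repeatWord u (n + 1) ++ y) ∈ L}
      ⟨(x ++ u, repeatWord u (n + 1) ++ y), rfl⟩ (by
        rw [show 3 + n = 1 + (1 + (n + 1)) by omega, repeatWord_add, repeatWord_add,
          repeatWord_one] at h
        change _ ∈ L
        simpa only [List.append_assoc] using h)
    refine ⟨0, n, ?_⟩
    change _ ∈ L at this
    rw [zero_add, repeatWord_one]
    simpa only [List.append_assoc] using this
  | union _ _ ihH ihL =>
    obtain ⟨D, hDC, hD, N, h⟩ := ihH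
    obtain ⟨D', hDC', hD', N', h'⟩ := ihL
    refine ⟨D ∪ D', Set.union_subset hDC hDC', hD.union hD', max N N', ?_⟩
    intro u v huv n hn x y hw
    rcases hw with hw | hw
    · obtain ⟨k, k', hk⟩ := h u v (fun K hK => huv K (Or.inl hK)) n
        ((le_max_left _ _).trans hn) x y hw
      exact ⟨k, k', Or.inl hk⟩
    · obtain ⟨k, k', hk⟩ := h' u v (fun K hK => huv K (Or.inr hK)) n
        ((le_max_right _ _).trans hn) x y hw
      exact ⟨k, k', Or.inr hk⟩
  | @marked H L a _ _ ihH ihL =>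
    obtain ⟨D, hDC, hD, N, h⟩ := ihH
    obtain ⟨D', hDC', hD', N', h'⟩ := ihL
    refine ⟨D ∪ D', Set.union_subset hDC hDC', hD.union hD', N + N', ?_⟩
    intro u v huv n hn x y hw
    obtain ⟨n, rfl⟩ := Nat.exists_eq_add_of_le hn
    rw [add_assoc, repeatWord_add] at hw
    obtain ⟨s, hs, t, ht, hst⟩ := mem_marked.1 hw
    -- Either the marked letter comes after the first `N` copies, and the replacement is made in the
    -- factor from `H`, or all later copies, at least `N'`, lie in the factor from `L`.
    have hleft : ∀ z, s = x ++ repeatWord u N ++ z →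
        z ++ a :: t = repeatWord u (N' + n) ++ y →
        ∃ k k', x ++ repeatWord u (k + 1) ++ v ++ repeatWord u (k' + 1) ++ y ∈ H * {[a]} * L := by
      rintro z rfl hz
      obtain ⟨k, k', hk⟩ := h u v (fun K hK => huv K (Or.inl hK)) N le_rfl x z hs
      refine ⟨k, k' + (N' + n), mem_marked.2 ⟨_, hk, t, ht, ?_⟩⟩
      rw [show k' + (N' + n) + 1 = (k' + 1) + (N' + n) by omega, repeatWord_add _ (k' + 1)]
      simp only [List.append_assoc, hz]
    have hst' : (x ++ repeatWord u N) ++ (repeatWord u (N' + n) ++ y) = s ++ a :: t := by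
      simpa only [List.append_assoc] using hst
    rcases List.append_eq_append_iff.1 hst' with ⟨z, hz, hz'⟩ | ⟨z, hz, hz'⟩
    · exact hleft z hz hz'.symm
    · rcases z with _ | ⟨b, z⟩
      · exact hleft [] (by simpa using hz.symm) (by simpa using hz')
      · simp only [List.cons_append, List.cons.injEq] at hz'
        obtain ⟨rfl, rfl⟩ := hz'
        obtain ⟨k, k', hk⟩ := h' u v (fun K hK => huv K (Or.inr hK)) (N' + n) (by omega) z y
          (by simpa only [List.append_assoc] using ht)
        refine ⟨N + k, k', mem_marked.2 ⟨s, hs, _, hk, ?_⟩⟩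
        rw [add_assoc, repeatWord_add _ N, ← List.append_assoc x, hz]
        simp

section Morphism

variable {M : Type*} [Monoid M] {α : FreeMonoid A →* M} {L : Language A}

/-- Otherwise a separator arises by taking, for each `u ∈ L₁`, the intersection of the members of
`D` containing `u`, and uniting these. As `D` is finite, only finitely many intersections occur. -/
theorem exists_of_not_separable (hC : IsQuotientingLattice C) {L₁ L₂ : Language A}
    (h : ¬ Separable C L₁ L₂) {D : Set (Language A)} (hDC : D ⊆ C) (hD : D.Finite) :
    ∃ u ∈ L₁, ∃ v ∈ L₂, ∀ K ∈ D, u ∈ K → v ∈ K := by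
  by_contra! hcon
  have := hD.to_subtype
  have hinter : ∀ E : {E : Set D // ∃ u ∈ L₁, E = {K : D | u ∈ K.1}}, ∃ K ∈ C,
      ∀ w, w ∈ K ↔ ∀ F : E.1, w ∈ F.1.1 := fun E =>
    exists_mem_iff_forall hC.univ_mem hC.inter_mem (fun F : E.1 => F.1.1) fun F => hDC F.1.2
  choose K hK hKw using hinter
  obtain ⟨S, hS, hSw⟩ := exists_mem_iff_exists hC.empty_mem hC.union_mem K hK
  refine h ⟨S, hS, fun u hu => ?_, ?_⟩
  · exact (hSw u).2 ⟨⟨_, u, hu, rfl⟩, (hKw _ u).2 fun F => F.2⟩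
  · refine le_bot_iff.1 fun v hv => ?_
    obtain ⟨⟨_, u, hu, rfl⟩, hE⟩ := (hSw v).1 hv.2
    obtain ⟨F, hF, huF, hvF⟩ := hcon u hu v hv.1
    exact (hvF ((hKw _ v).1 hE ⟨⟨F, hF⟩, huF⟩)).elim

theorem map_repeatWord_succ {u : List A} (hu : α u * α u = α u) (n : ℕ) :
    α (repeatWord u (n + 1)) = α u := by
  induction n with
  | zero => rw [zero_add, repeatWord_one]
  | succ n ih => rw [repeatWord_add, map_append, ih, repeatWord_one, hu]

theorem polCriterion_of_inPol (hC : IsQuotientingLattice C) (hL : Recognizes α L)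
    (h : InPol C L) : PolCriterion α C L := by
  intro u v hu hsep x y hxy
  rw [map_append] at hu
  obtain ⟨D, hDC, hD, N, hN⟩ := h.exists_finite_insert hC
  obtain ⟨u', hu', v', hv', huv⟩ := exists_of_not_separable hC hsep hDC hD
  replace hu' : α u' = α u := hu'
  replace hv' : α v' = α v := hv'
  have hpow : ∀ n, α (repeatWord u' (n + 1)) = α u := fun n =>
    (map_repeatWord_succ (by rw [hu', hu]) n).trans hu'
  -- The exponent must be positive: a nonempty power of `u'` has the idempotent image `α u`, while
  -- the empty power has image `1`. The positive exponents `k + 1` and `k' + 1` serve the same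
  -- purpose.
  obtain ⟨k, k', hk⟩ := hN u' v' huv (N + 1) (Nat.le_succ N) x y
    (hL _ _ (by simp only [map_append, hpow]) hxy)
  exact hL _ _ (by simp only [map_append, hpow, hv', mul_assoc]) hk

theorem mem_pol_iff_polCriterion [Finite A] [Finite M] (hC : IsQuotientingLattice C)
    (hL : Recognizes α L) : L ∈ Pol C ↔ PolCriterion α C L :=
  ⟨polCriterion_of_inPol hC hL, inPol_of_polCriterion hC hL⟩

end Morphism

end PolClosure

/-! ### Computable predicates and the transition monoid of an automaton. -/

namespace PolClosure

variable {A : Type*}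

section Computability

variable {β γ : Type*} [Primcodable β] [Primcodable γ]

theorem _root_.ComputablePred.forall_mem_list {l : β → List γ} (hl : Computable l)
    {p : β → γ → Prop} (hp : ComputablePred fun z : β × γ => p z.1 z.2) :
    ComputablePred fun b => ∀ c ∈ l b, p b c := by
  classical
  let f : β × γ → Bool := fun z => decide (p z.1 z.2)
  have hf : Computable f := hp.decide
  -- `g b n` tests the first `n` entries; the default `true` beyond the end of the list is harmless.
  let g : β → ℕ → Bool := fun b n =>
    Nat.rec true (fun i r => r && Option.casesOn ((l b)[i]?) true fun c => f (b, c)) n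
  have hg : Computable fun b => g b (l b).length := by
    refine Computable.nat_rec (h := fun b (z : ℕ × Bool) =>
      z.2 && Option.casesOn ((l b)[z.1]?) true fun c => f (b, c))
      (Computable.list_length.comp hl) (Computable.const true) ?_
    refine Primrec.and.to_comp.comp (Computable.snd.comp Computable.snd) ?_
    refine Computable.option_casesOn (Computable.list_getElem?.comp (hl.comp Computable.fst)
      (Computable.fst.comp Computable.snd)) (Computable.const true) ?_
    exact hf.comp (Computable.pair (Computable.fst.comp Computable.fst) Computable.snd)
  have hgs : ∀ b n, g b n = true ↔ ∀ i < n, ∀ c, (l b)[i]? = some c → p b c := by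
    intro b n
    induction n with
    | zero => simp [g]
    | succ n ih =>
      have hrec : g b (n + 1) =
        (g b n && Option.casesOn ((l b)[n]?) true fun c => f (b, c)) := rfl
      rw [hrec, Bool.and_eq_true, ih, Nat.forall_lt_succ_right]
      refine and_congr_right fun _ => ?_
      cases (l b)[n]? <;> simp [f]
  refine ComputablePred.computable_iff.2 ⟨_, hg, funext fun b => propext ?_⟩
  rw [hgs]
  constructor
  · exact fun h i _ c hc => h c (List.mem_of_getElem? hc)
  · intro h c hc
    obtain ⟨i, hi, rfl⟩ := List.mem_iff_getElem.1 hc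
    exact h i hi _ (List.getElem?_eq_getElem hi)

theorem _root_.ComputablePred.comp {p : γ → Prop} (hp : ComputablePred p) {f : β → γ}
    (hf : Computable f) : ComputablePred fun b => p (f b) := by
  obtain ⟨g, hg, rfl⟩ := ComputablePred.computable_iff.1 hp
  exact ComputablePred.computable_iff.2 ⟨fun b => g (f b), hg.comp hf, rfl⟩

theorem _root_.ComputablePred.or {p q : β → Prop} (hp : ComputablePred p)
    (hq : ComputablePred q) : ComputablePred fun b => p b ∨ q b := by
  classical
  refine ComputablePred.computable_iff.2
    ⟨_, Primrec.or.to_comp.comp hp.decide hq.decide, funext fun b => ?_⟩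
  simp

end Computability

namespace Automaton

/-- The initial states and the targets of transitions. -/
def states (M : Automaton A) : List ℕ := M.1 ++ M.2.1.map fun t => t.2.2

theorem mem_evalFrom_singleton_append (M : Automaton A) (p q : ℕ) (u v : List A) :
    q ∈ M.toNFA.evalFrom {p} (u ++ v) ↔
      ∃ r, r ∈ M.toNFA.evalFrom {p} u ∧ q ∈ M.toNFA.evalFrom {r} v := by
  rw [NFA.evalFrom_append, NFA.mem_evalFrom_iff_exists]

theorem mem_states_of_mem_evalFrom {M : Automaton A} {p q : ℕ} (hp : p ∈ M.states) {u : List A}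
    (hq : q ∈ M.toNFA.evalFrom {p} u) : q ∈ M.states := by
  induction u using List.reverseRecOn generalizing q with
  | nil =>
    obtain rfl : q = p := hq
    exact hp
  | append_singleton u a _ =>
    rw [NFA.evalFrom_append, NFA.evalFrom_singleton, NFA.mem_stepSet] at hq
    obtain ⟨r, _, hr⟩ := hq
    exact List.mem_append_right _ (List.mem_map.2 ⟨(r, a, q), hr, rfl⟩)

/-- The kernel of the morphism to the transition monoid of `M`. -/
def transitionCon (M : Automaton A) : Con (FreeMonoid A) where
  r u v := ∀ p ∈ M.states, ∀ q ∈ M.states,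
    (q ∈ M.toNFA.evalFrom {p} u ↔ q ∈ M.toNFA.evalFrom {p} v)
  iseqv := ⟨fun _ _ _ _ _ => Iff.rfl, fun h p hp q hq => (h p hp q hq).symm,
    fun h h' p hp q hq => (h p hp q hq).trans (h' p hp q hq)⟩
  mul' := by
    intro u u' v v' h h' p hp q hq
    change q ∈ M.toNFA.evalFrom {p} (_ ++ _) ↔ q ∈ M.toNFA.evalFrom {p} (_ ++ _)
    rw [mem_evalFrom_singleton_append, mem_evalFrom_singleton_append]
    refine exists_congr fun r => ?_
    constructor
    · rintro ⟨hr, hr'⟩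
      have hrs := mem_states_of_mem_evalFrom hp hr
      exact ⟨(h p hp r hrs).1 hr, (h' r hrs q hq).1 hr'⟩
    · rintro ⟨hr, hr'⟩
      have hrs := mem_states_of_mem_evalFrom hp hr
      exact ⟨(h p hp r hrs).2 hr, (h' r hrs q hq).2 hr'⟩

/-- The morphism from words to the transition monoid of `M`. -/
def transitionHom (M : Automaton A) : FreeMonoid A →* M.transitionCon.Quotient :=
  M.transitionCon.mk'

theorem transitionHom_eq_iff (M : Automaton A) (u v : List A) :
    M.transitionHom u = M.transitionHom v ↔ ∀ p ∈ M.states, ∀ q ∈ M.states,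
      (q ∈ M.toNFA.evalFrom {p} u ↔ q ∈ M.toNFA.evalFrom {p} v) :=
  M.transitionCon.eq

theorem mem_language_iff (M : Automaton A) (u : List A) :
    u ∈ M.language ↔ ∃ p ∈ M.1, ∃ q ∈ M.2.2, q ∈ M.toNFA.evalFrom {p} u := by
  change (∃ q ∈ M.2.2, q ∈ M.toNFA.evalFrom {p | p ∈ M.1} u) ↔ _
  simp only [NFA.mem_evalFrom_iff_exists (S := {p | p ∈ M.1})]
  constructor
  · rintro ⟨q, hq, p, hp, h⟩
    exact ⟨p, hp, q, hq, h⟩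
  · rintro ⟨p, hp, q, hq, h⟩
    exact ⟨q, hq, p, hp, h⟩

/-- A run from an initial state never leaves `states`, so the transition relation on that list
decides acceptance. -/
theorem recognizes_transitionHom (M : Automaton A) : Recognizes M.transitionHom M.language := by
  intro u v huv
  rw [transitionHom_eq_iff] at huv
  rw [mem_language_iff, mem_language_iff]
  rintro ⟨p, hp, q, hq, h⟩
  have hps : p ∈ M.states := List.mem_append_left _ hp
  exact ⟨p, hp, q, hq, (huv p hps q (mem_states_of_mem_evalFrom hps h)).1 h⟩

theorem exists_injective_quotient (M : Automaton A) :
    ∃ f : M.transitionCon.Quotient → Set ({p // p ∈ M.states} × {p // p ∈ M.states}),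
      Function.Injective f := by
  refine ⟨fun x => {z | z.2.1 ∈ M.toNFA.evalFrom {z.1.1} (Quotient.out x : FreeMonoid A)},
    fun x y h => ?_⟩
  rw [← Quotient.out_eq x, ← Quotient.out_eq y]
  refine (M.transitionHom_eq_iff _ _).2 fun p hp q hq => ?_
  exact Set.ext_iff.1 h (⟨p, hp⟩, ⟨q, hq⟩)

instance (M : Automaton A) : Finite M.transitionCon.Quotient := by
  obtain ⟨f, hf⟩ := M.exists_injective_quotient
  exact Finite.of_injective f hf

/-- An upper bound for the size of the transition monoid. -/
def sizeBound (M : Automaton A) : ℕ := 2 ^ (M.states.length * M.states.length)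

theorem card_quotient_le (M : Automaton A) :
    Nat.card M.transitionCon.Quotient ≤ M.sizeBound := by
  classical
  obtain ⟨f, hf⟩ := M.exists_injective_quotient
  refine (Nat.card_le_card_of_injective f hf).trans ?_
  have hle : Fintype.card {p // p ∈ M.states} ≤ M.states.length := by
    rw [Fintype.card_of_subtype M.states.toFinset (by simp)]
    exact M.states.toFinset_card_le
  rw [Nat.card_eq_fintype_card, Fintype.card_set, Fintype.card_prod]
  exact Nat.pow_le_pow_right two_pos (Nat.mul_le_mul hle hle)

end Automaton

/-- The image of a word under a morphism to a finite monoid is the image of a short word. -/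
theorem exists_length_le_of_finite {M : Type*} [Monoid M] [Finite M] (α : FreeMonoid A →* M)
    (u : List A) : ∃ v : List A, v.length ≤ Nat.card M ∧ α v = α u := by
  have := Fintype.ofFinite M
  -- The right Cayley graph of `M` as an automaton: a long word contains a loop, and deleting it
  -- keeps the image.
  let D : DFA A M := ⟨fun m a => m * α (FreeMonoid.of a), 1, ∅⟩
  have hD : ∀ (w : List A) (m : M), D.evalFrom m w = m * α w := by
    intro w
    induction w with
    | nil => intro m; exact ((congrArg (m * ·) (map_one α)).trans (mul_one m)).symm
    | cons a w ih =>
      intro m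
      rw [DFA.evalFrom_cons, ih]
      change m * α (FreeMonoid.of a) * α w = m * α ([a] ++ w : List A)
      rw [map_append, mul_assoc]
      rfl
  induction hn : u.length using Nat.strong_induction_on generalizing u with
  | _ n ih =>
  rcases le_total u.length (Nat.card M) with h | h
  · exact ⟨u, h, rfl⟩
  rw [Nat.card_eq_fintype_card] at h
  obtain ⟨q, a, b, c, rfl, -, hb, ha, hq, hc⟩ := D.evalFrom_split h (s := 1) rfl
  obtain ⟨v, hv, hvu⟩ := ih (a ++ c).length (by
    have := List.length_pos_iff.2 hb
    simp only [List.length_append] at hn ⊢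
    omega) (a ++ c) rfl
  refine ⟨v, hv, hvu.trans ?_⟩
  rw [hD] at ha hq
  rw [map_append, map_append, map_append]
  rw [one_mul] at ha
  rw [ha, hq]

end PolClosure

/-! ### Effective representatives, automata for fibers, and the decision procedure. -/

namespace PolClosure

variable {A : Type*}

/-- All words of length at most `n`, over the letters in `l`. -/
def shortWords (l : List A) (n : ℕ) : List (List A) :=
  n.rec [[]] fun _ W => [] :: W.flatMap fun w => l.map fun a => a :: w

theorem mem_shortWords {l : List A} (hl : ∀ a, a ∈ l) {n : ℕ} {w : List A}
    (hw : w.length ≤ n) : w ∈ shortWords l n := by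
  induction n generalizing w with
  | zero =>
    obtain rfl : w = [] := List.length_eq_zero_iff.1 (Nat.le_zero.1 hw)
    exact List.mem_singleton.2 rfl
  | succ n ih =>
    change w ∈ [] :: (shortWords l n).flatMap fun w => l.map fun a => a :: w
    rcases w with _ | ⟨a, w⟩
    · exact List.mem_cons_self
    · refine List.mem_cons_of_mem _ (List.mem_flatMap.2 ⟨w, ih (by simpa using hw), ?_⟩)
      exact List.mem_map.2 ⟨a, hl a, rfl⟩

theorem primrec_shortWords [Primcodable A] (l : List A) : Primrec (shortWords l) := by
  refine Primrec.nat_rec₁ _ (f := fun _ (W : List (List A)) =>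
    [] :: W.flatMap fun w => l.map fun a => a :: w) ?_
  refine Primrec.list_cons.comp (Primrec.const []) ?_
  refine Primrec.list_flatMap Primrec.snd ?_
  refine Primrec.list_map (Primrec.const l) ?_
  exact Primrec.list_cons.comp Primrec.snd (Primrec.snd.comp Primrec.fst)

namespace Automaton

/-- Words that represent all elements of the transition monoid of `M`. -/
noncomputable def representatives [Finite A] (M : Automaton A) : List (List A) :=
  shortWords (Set.finite_univ (α := A)).toFinset.toList M.sizeBound

theorem exists_mem_representatives [Finite A] (M : Automaton A) (u : List A) :
    ∃ v ∈ M.representatives, M.transitionHom v = M.transitionHom u := by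
  obtain ⟨v, hv, hvu⟩ := exists_length_le_of_finite M.transitionHom u
  exact ⟨v, mem_shortWords (by simp) (hv.trans M.card_quotient_le), hvu⟩

open Classical in
/-- An automaton for the words with the same image as `u` in the transition monoid of `M`. -/
noncomputable def fiberAutomaton [Finite A] [Encodable A] (M : Automaton A) (u : List A) :
    Automaton A :=
  ((M.representatives.filter fun w : List A =>
      M.transitionHom w = M.transitionHom []).map Encodable.encode,
    M.representatives.flatMap fun w => (Set.finite_univ (α := A)).toFinset.toList.flatMap fun a =>
      (M.representatives.filter fun w' : List A =>
        M.transitionHom w' = M.transitionHom (w ++ [a])).map fun w' : List A =>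
          (Encodable.encode w, a, Encodable.encode w'),
    (M.representatives.filter fun w : List A =>
      M.transitionHom w = M.transitionHom u).map Encodable.encode)

/-- Several representatives may denote one element of the transition monoid, so the automaton moves
to all of them at once. This avoids choosing a canonical one. -/
theorem mem_evalFrom_fiberAutomaton [Finite A] [Encodable A] (M : Automaton A) (u z : List A)
    (n : ℕ) : n ∈ (M.fiberAutomaton u).toNFA.evalFrom (M.fiberAutomaton u).toNFA.start z ↔
      ∃ w ∈ M.representatives, M.transitionHom w = M.transitionHom z ∧ Encodable.encode w = n := by
  classical
  induction z using List.reverseRecOn generalizing n with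
  | nil =>
    change n ∈ (M.fiberAutomaton u).1 ↔ _
    simp [fiberAutomaton, and_assoc]
  | append_singleton z a ih =>
    rw [NFA.evalFrom_append, NFA.evalFrom_singleton, NFA.mem_stepSet]
    simp only [ih]
    have hstep : ∀ m, n ∈ (M.fiberAutomaton u).toNFA.step m a ↔
        ∃ w ∈ M.representatives, ∃ w' ∈ M.representatives,
          M.transitionHom w' = M.transitionHom (w ++ [a] : List A) ∧ Encodable.encode w = m ∧
            Encodable.encode w' = n := by
      intro m
      change (m, a, n) ∈ (M.fiberAutomaton u).2.1 ↔ _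
      simp [fiberAutomaton, and_assoc]
      rfl
    simp only [hstep]
    constructor
    · rintro ⟨_, ⟨w, -, hwz, rfl⟩, w₁, -, w', hw', hw₁, he, rfl⟩
      obtain rfl := Encodable.encode_injective he
      exact ⟨w', hw', by rw [hw₁, map_append, map_append, hwz], rfl⟩
    · rintro ⟨w', hw', hw'z, rfl⟩
      obtain ⟨w, hw, hwz⟩ := M.exists_mem_representatives z
      refine ⟨_, ⟨w, hw, hwz, rfl⟩, w, hw, w', hw', ?_, rfl, rfl⟩
      rw [hw'z, map_append, map_append, hwz]

theorem language_fiberAutomaton [Finite A] [Encodable A] (M : Automaton A) (u : List A) :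
    (M.fiberAutomaton u).language = fiber M.transitionHom u := by
  classical
  ext z
  have hacc : ∀ n, n ∈ (M.fiberAutomaton u).toNFA.accept ↔ ∃ w ∈ M.representatives,
      M.transitionHom w = M.transitionHom u ∧ Encodable.encode w = n := by
    intro n
    change n ∈ (M.fiberAutomaton u).2.2 ↔ _
    simp [fiberAutomaton, and_assoc]
  change (∃ n ∈ (M.fiberAutomaton u).toNFA.accept,
    n ∈ (M.fiberAutomaton u).toNFA.evalFrom (M.fiberAutomaton u).toNFA.start z) ↔
    M.transitionHom z = M.transitionHom u
  simp only [hacc, mem_evalFrom_fiberAutomaton]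
  constructor
  · rintro ⟨_, ⟨w, -, hwu, rfl⟩, w', -, hwz, he⟩
    obtain rfl := Encodable.encode_injective he
    exact hwz.symm.trans hwu
  · intro h
    obtain ⟨w, hw, hwz⟩ := M.exists_mem_representatives z
    exact ⟨_, ⟨w, hw, hwz.trans h, rfl⟩, w, hw, hwz, rfl⟩

section Primrec

variable [Primcodable A]

theorem primrec_states : Primrec (states : Automaton A → List ℕ) :=
  Primrec.list_append.comp Primrec.fst (Primrec.list_map (Primrec.fst.comp Primrec.snd)
    ((Primrec.snd.comp Primrec.snd).comp Primrec.snd))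

theorem primrec_sizeBound : Primrec (sizeBound : Automaton A → ℕ) := by
  have hpow : Primrec fun n : ℕ => 2 ^ n := by
    refine (Primrec.nat_rec₁ 1 (f := fun _ r => r + r)
      (Primrec.nat_add.comp Primrec.snd Primrec.snd)).of_eq fun n => ?_
    induction n with
    | zero => rfl
    | succ n ih => rw [pow_succ, ← ih, mul_two]
  have hlen : Primrec fun M : Automaton A => M.states.length :=
    Primrec.list_length.comp primrec_states
  exact hpow.comp (Primrec.nat_mul.comp hlen hlen)

/-- The noncomputably chosen list of letters does not depend on the automaton, so it enters as a
constant. -/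
theorem primrec_representatives [Finite A] :
    Primrec (representatives : Automaton A → List (List A)) :=
  (primrec_shortWords _).comp primrec_sizeBound

variable {β : Type*} [Primcodable β] {M : β → Automaton A} {u v : β → List A} {p q : β → ℕ}

/-- The subset construction, with sets of states as lists: the word is read by a fold from the list
`[p]`. -/
theorem primrecPred_mem_evalFrom (hM : Primrec M) (hu : Primrec u) (hp : Primrec p)
    (hq : Primrec q) : PrimrecPred fun b => q b ∈ (M b).toNFA.evalFrom {p b} (u b) := by
  classical
  let next : Automaton A → List ℕ → A → List ℕ := fun M S a =>
    (M.2.1.filter fun t => (∃ p ∈ S, p = t.1) ∧ t.2.1 = a).map fun t => t.2.2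
  have hnext : ∀ M S a, {q | q ∈ next M S a} = M.toNFA.stepSet {q | q ∈ S} a := by
    intro M S a
    ext q
    simp only [next, Set.mem_ofPred_eq, List.mem_map, List.mem_filter, NFA.mem_stepSet,
      decide_eq_true_eq]
    constructor
    · rintro ⟨⟨p, b, q⟩, ⟨ht, ⟨_, hp, rfl⟩, rfl⟩, rfl⟩
      exact ⟨_, hp, ht⟩
    · rintro ⟨p, hp, ht⟩
      exact ⟨(p, a, q), ⟨ht, ⟨p, hp, rfl⟩, rfl⟩, rfl⟩
  have heval : ∀ (M : Automaton A) (w : List A) (S : List ℕ),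
      {q | q ∈ w.foldl (next M) S} = M.toNFA.evalFrom {q | q ∈ S} w := by
    intro M w
    induction w with
    | nil => intro S; rfl
    | cons a w ih => intro S; rw [List.foldl_cons, ih, hnext, NFA.evalFrom_cons]
  have hmem : PrimrecRel fun (S : List ℕ) (p : ℕ) => ∃ q ∈ S, q = p :=
    PrimrecRel.exists_mem_list Primrec.eq
  have hprim : Primrec fun z : Automaton A × List ℕ × A => next z.1 z.2.1 z.2.2 := by
    refine Primrec.list_map ?_ ((Primrec.snd.comp Primrec.snd).comp Primrec.snd)
    have hrel : PrimrecRel fun (t : ℕ × A × ℕ) (y : List ℕ × A) =>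
        (∃ p ∈ y.1, p = t.1) ∧ t.2.1 = y.2 :=
      PrimrecPred.and
        (hmem.comp (Primrec.fst.comp Primrec.snd) (Primrec.fst.comp Primrec.fst))
        (Primrec.eq.comp (Primrec.fst.comp (Primrec.snd.comp Primrec.fst))
          (Primrec.snd.comp Primrec.snd))
    exact hrel.listFilter.comp (Primrec.fst.comp (Primrec.snd.comp Primrec.fst)) Primrec.snd
  have hfold : Primrec fun b => (u b).foldl (next (M b)) [p b] := by
    refine Primrec.list_foldl (h := fun b (y : List ℕ × A) => next (M b) y.1 y.2) hu
      (Primrec.list_cons.comp hp (Primrec.const [])) ?_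
    exact hprim.comp (Primrec.pair (hM.comp Primrec.fst) Primrec.snd)
  refine (hmem.comp hfold hq).of_eq fun b => ?_
  have := Set.ext_iff.1 (heval (M b) (u b) [p b]) (q b)
  simpa using this

theorem primrecPred_mem_language (hM : Primrec M) (hu : Primrec u) :
    PrimrecPred fun b => u b ∈ (M b).language := by
  have h₁ : PrimrecRel fun (q : ℕ) (y : β × ℕ) => q ∈ (M y.1).toNFA.evalFrom {y.2} (u y.1) :=
    primrecPred_mem_evalFrom (hM.comp (Primrec.fst.comp Primrec.snd))
      (hu.comp (Primrec.fst.comp Primrec.snd)) (Primrec.snd.comp Primrec.snd) Primrec.fst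
  have h₂ : PrimrecRel fun (p : ℕ) (b : β) =>
      ∃ q ∈ (M b).2.2, q ∈ (M b).toNFA.evalFrom {p} (u b) :=
    PrimrecRel.comp (f := fun y : ℕ × β => (M y.2).2.2) (g := fun y : ℕ × β => (y.2, y.1))
      h₁.exists_mem_list (Primrec.snd.comp (Primrec.snd.comp (hM.comp Primrec.snd)))
      (Primrec.pair Primrec.snd Primrec.fst)
  refine (h₂.exists_mem_list.comp (Primrec.fst.comp hM) Primrec.id).of_eq fun b => ?_
  exact (mem_language_iff (M b) (u b)).symm

theorem primrecPred_transitionHom_eq (hM : Primrec M) (hu : Primrec u) (hv : Primrec v) :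
    PrimrecPred fun b => (M b).transitionHom (u b) = (M b).transitionHom (v b) := by
  have h₁ : PrimrecRel fun (q : ℕ) (y : β × ℕ) =>
      (q ∈ (M y.1).toNFA.evalFrom {y.2} (u y.1) ↔ q ∈ (M y.1).toNFA.evalFrom {y.2} (v y.1)) := by
    have hb : Primrec fun y : ℕ × β × ℕ => y.2.1 := Primrec.fst.comp Primrec.snd
    have hp : Primrec fun y : ℕ × β × ℕ => y.2.2 := Primrec.snd.comp Primrec.snd
    have hu' := primrecPred_mem_evalFrom (hM.comp hb) (hu.comp hb) hp Primrec.fst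
    have hv' := primrecPred_mem_evalFrom (hM.comp hb) (hv.comp hb) hp Primrec.fst
    exact ((hu'.and hv').or (hu'.not.and hv'.not)).of_eq fun y => iff_iff_and_or_not_and_not.symm
  have h₂ : PrimrecRel fun (p : ℕ) (b : β) => ∀ q ∈ (M b).states,
      (q ∈ (M b).toNFA.evalFrom {p} (u b) ↔ q ∈ (M b).toNFA.evalFrom {p} (v b)) :=
    PrimrecRel.comp (f := fun y : ℕ × β => (M y.2).states) (g := fun y : ℕ × β => (y.2, y.1))
      h₁.forall_mem_list (primrec_states.comp (hM.comp Primrec.snd))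
      (Primrec.pair Primrec.snd Primrec.fst)
  refine (h₂.forall_mem_list.comp (primrec_states.comp hM) Primrec.id).of_eq fun b => ?_
  exact (transitionHom_eq_iff (M b) (u b) (v b)).symm

theorem primrec_fiberAutomaton [Finite A] :
    Primrec fun z : Automaton A × List A => z.1.fiberAutomaton z.2 := by
  classical
  have hfilter : Primrec fun z : Automaton A × List A => z.1.representatives.filter fun w : List A =>
      z.1.transitionHom w = z.1.transitionHom z.2 := by
    have hrel : PrimrecRel fun (w : List A) (z : Automaton A × List A) =>
        z.1.transitionHom w = z.1.transitionHom z.2 :=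
      primrecPred_transitionHom_eq (Primrec.fst.comp Primrec.snd) Primrec.fst
        (Primrec.snd.comp Primrec.snd)
    exact hrel.listFilter.comp (primrec_representatives.comp Primrec.fst) Primrec.id
  have henc : ∀ {β : Type _} [Primcodable β],
      Primrec₂ fun (_ : β) (w : List A) => Encodable.encode w := fun {β} _ =>
    Primrec.encode.comp Primrec.snd
  refine Primrec.pair ?_ (Primrec.pair ?_ ?_)
  · exact Primrec.list_map (hfilter.comp (Primrec.pair Primrec.fst (Primrec.const []))) henc
  · refine Primrec.list_flatMap (primrec_representatives.comp Primrec.fst) ?_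
    refine Primrec.list_flatMap (Primrec.const _) ?_
    refine Primrec.list_map (hfilter.comp (Primrec.pair
      (Primrec.fst.comp (Primrec.fst.comp Primrec.fst))
      (Primrec.list_concat.comp (Primrec.snd.comp Primrec.fst) Primrec.snd))) ?_
    exact Primrec.pair
      (Primrec.encode.comp (Primrec.snd.comp (Primrec.fst.comp Primrec.fst)))
      (Primrec.pair (Primrec.snd.comp Primrec.fst) (Primrec.encode.comp Primrec.snd))
  · exact Primrec.list_map hfilter henc

end Primrec

end Automaton

/-- All conditions depend only on images in the transition monoid, including those on the contexts
`x` and `y`, because this monoid recognizes the language. The disjunctive form separates a primitive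
recursive test from a single positive call to separation. -/
theorem polCriterion_iff_representatives [Finite A] [Encodable A] (C : Set (Language A))
    (M : Automaton A) :
    PolCriterion M.transitionHom C M.language ↔
      ∀ u ∈ M.representatives, ∀ v ∈ M.representatives, ∀ x ∈ M.representatives,
        ∀ y ∈ M.representatives,
          (M.transitionHom (u ++ u : List A) ≠ M.transitionHom u ∨ x ++ u ++ y ∉ M.language ∨
            x ++ (u ++ v ++ u) ++ y ∈ M.language) ∨
          Separable C (M.fiberAutomaton u).language (M.fiberAutomaton v).language := by
  simp only [Automaton.language_fiberAutomaton]
  constructor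
  · intro h u _ v _ x _ y _
    by_contra! hcon
    obtain ⟨⟨hu, hx, hy⟩, hs⟩ := hcon
    exact hy (h u v hu hs x y hx)
  · intro h u v hu hs x y hxy
    obtain ⟨u', hu'M, hu'⟩ := M.exists_mem_representatives u
    obtain ⟨v', hv'M, hv'⟩ := M.exists_mem_representatives v
    obtain ⟨x', hx'M, hx'⟩ := M.exists_mem_representatives x
    obtain ⟨y', hy'M, hy'⟩ := M.exists_mem_representatives y
    have hfib : ∀ {w w' : List A}, M.transitionHom w = M.transitionHom w' →
        fiber M.transitionHom w = fiber M.transitionHom w' := fun h => by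
      unfold fiber
      rw [h]
    have hrec := M.recognizes_transitionHom
    rcases h u' hu'M v' hv'M x' hx'M y' hy'M with (h | h | h) | h
    · refine (h ?_).elim
      rw [map_append] at hu ⊢
      rw [hu', hu]
    · exact (h (hrec _ _ (by simp only [map_append, hu', hx', hy']) hxy)).elim
    · exact hrec _ _ (by simp only [map_append, hu', hv', hx', hy']) h
    · rw [hfib hu', hfib hv'] at h
      exact (hs h).elim

section Decidability

variable [Primcodable A] {β : Type*} [Primcodable β] {M : β → Automaton A}
  {u v x y : β → List A}

theorem primrecPred_insertion (hM : Primrec M) (hu : Primrec u) (hv : Primrec v)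
    (hx : Primrec x) (hy : Primrec y) : PrimrecPred fun b =>
      (M b).transitionHom (u b ++ u b : List A) ≠ (M b).transitionHom (u b) ∨
        x b ++ u b ++ y b ∉ (M b).language ∨
        x b ++ (u b ++ v b ++ u b) ++ y b ∈ (M b).language := by
  refine PrimrecPred.or ?_ (PrimrecPred.or ?_ ?_)
  · exact (Automaton.primrecPred_transitionHom_eq hM (Primrec.list_append.comp hu hu) hu).not
  · exact (Automaton.primrecPred_mem_language hM
      (Primrec.list_append.comp (Primrec.list_append.comp hx hu) hy)).not
  · exact Automaton.primrecPred_mem_language hM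
      (Primrec.list_append.comp (Primrec.list_append.comp hx
        (Primrec.list_append.comp (Primrec.list_append.comp hu hv) hu)) hy)

theorem SeparationDecidable.fiberAutomaton [Finite A] {C : Set (Language A)}
    (hsep : SeparationDecidable C) (hM : Primrec M) (hu : Primrec u) (hv : Primrec v) :
    ComputablePred fun b => Separable C ((M b).fiberAutomaton (u b)).language
      ((M b).fiberAutomaton (v b)).language := by
  have hfiber : ∀ {w : β → List A}, Primrec w → Primrec fun b => (M b).fiberAutomaton (w b) :=
    fun {w} hw => Primrec.comp (f := fun z : Automaton A × List A => z.1.fiberAutomaton z.2)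
      (g := fun b => (M b, w b)) Automaton.primrec_fiberAutomaton (Primrec.pair hM hw)
  exact ComputablePred.comp
    (p := fun M : Automaton A × Automaton A => Separable C M.1.language M.2.language)
    (f := fun b => ((M b).fiberAutomaton (u b), (M b).fiberAutomaton (v b)))
    hsep (Primrec.pair (hfiber hu) (hfiber hv)).to_comp

theorem membershipDecidable_pol [Finite A] {C : Set (Language A)}
    (hC : IsQuotientingLattice C) (hsep : SeparationDecidable C) :
    MembershipDecidable (Pol C) := by
  have hiff : ∀ M : Automaton A, _ ↔ M.language ∈ Pol C := fun M =>
    ((mem_pol_iff_polCriterion hC M.recognizes_transitionHom).trans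
      (polCriterion_iff_representatives C M)).symm
  refine ComputablePred.of_eq ?_ hiff
  have hW : Computable (Automaton.representatives : Automaton A → List (List A)) :=
    Automaton.primrec_representatives.to_comp
  -- Each quantifier pairs its word with the previous data, so the innermost predicate is on `((((M,
  -- u), v), x), y)`.
  refine ComputablePred.forall_mem_list hW (ComputablePred.forall_mem_list (hW.comp .fst)
    (ComputablePred.forall_mem_list (hW.comp (.comp .fst .fst))
      (ComputablePred.forall_mem_list (hW.comp (.comp .fst (.comp .fst .fst))) ?_)))
  have hx : Primrec fun z : (((Automaton A × List A) × List A) × List A) × List A => z.1.2 :=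
    Primrec.snd.comp Primrec.fst
  have hv : Primrec fun z : (((Automaton A × List A) × List A) × List A) × List A => z.1.1.2 :=
    Primrec.snd.comp (Primrec.fst.comp Primrec.fst)
  have hMu : Primrec fun z : (((Automaton A × List A) × List A) × List A) × List A => z.1.1.1 :=
    Primrec.fst.comp (Primrec.fst.comp Primrec.fst)
  have hM := Primrec.fst.comp hMu
  have hu := Primrec.snd.comp hMu
  exact (primrecPred_insertion hM hu hv hx Primrec.snd).computablePred.or
    (hsep.fiberAutomaton hM hu hv)

end Decidability

end PolClosure

theorem mainTheorem2 {A : Type*} [Finite A] [Primcodable A] (C : Set (Language A))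
    (hC : PolClosure.IsQuotientingLattice C) (hsep : PolClosure.SeparationDecidable C) :
    PolClosure.MembershipDecidable (PolClosure.Pol C) :=
  PolClosure.membershipDecidable_pol hC hsep
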